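/- Let $(F,g_F)$ be a connected smooth Riemannian manifold of dimension $n-1\ge 2$, and let $\overline M=\mathbb R\times F$ carry the Lorentzian product metric $\overline g=-dt^2+g_F$ and the time orientation given by $\partial_t$. Let $\psi:M^k\to\overline M$ ($k\ge 1$) be a smooth spacelike immersion of a connected manifold $M$, i.e. the induced metric $g=\psi^*\overline g$ is Riemannian. Let $\mathrm{II}(X,Y)=-(\overline\nabla_XY)^\perp$ be its second fundamental form and $\overrightarrow H=\frac1k\,\mathrm{trace}_g\,\mathrm{II}$ its mean curvature vector, and let $\tau$ be its height function, the $\mathbb R$-component of $\psi$. The immersion is called weakly future (past) trapped if $\overrightarrow H$ is causal (nonzero, with $\overline g(\overrightarrow H,\overrightarrow H)\le 0$) and future (past) pointing at every point of $M$, weakly trapped if it is weakly future trapped or weakly past trapped, and extremal if $\overrightarrow H=0$ everywhere. Suppose that $(M,g)$ is parabolic, i.e. every $C^2$ function $u$ on $M$ which is bounded from below and satisfies $\Delta_g u\le 0$ is constant (closed manifolds $M$ are allowed). Then: 1. If $\psi(M)$ is contained in a slab, i.e. $a\le\tau\le b$ for some $a,b\in\mathbb R$, then $\psi$ is not weakly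 trapped. 2. $\psi$ is extremal and bounded away from future or past infinity (i.e. $\sup_M\tau<+\infty$ or $\inf_M\tau>-\infty$) if and only if $\psi$ is a minimal submanifold of a spacelike slice, i.e. there is $t_0\in\mathbb R$ with $\psi(M)\subset\{t_0\}\times F$ and the immersion $\pi_F\circ\psi:M\to(F,g_F)$ has zero mean curvature vector. -/

import Mathlib

open scoped Manifold ContDiff

noncomputable section

namespace LorentzProduct

section General

variable {E : Type*} [NormedAddCommGroup E] [NormedSpace ℝ E]
  {H : Type*} [TopologicalSpace H]
  {E' : Type*} [NormedAddCommGroup E'] [NormedSpace ℝ E']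
  {H' : Type*} [TopologicalSpace H']

/-- A field of bilinear forms on the tangent spaces of the manifold `N`.  In Mathlib the tangent
space `TangentSpace J x` at any point `x` is by definition the model vector space `E'`, identified
with `T_x N` through the preferred chart at `x`. -/
abbrev FormField (_J : ModelWithCorners ℝ E' H') (N : Type*) [TopologicalSpace N]
    [ChartedSpace H' N] : Type _ := N → E' →L[ℝ] E' →L[ℝ] ℝ

/-- The differential of `ψ : M → N` at `p`, as a linear map `T_p M → T_{ψ p} N`. -/
def differential (I : ModelWithCorners ℝ E H) (J : ModelWithCorners ℝ E' H')
    {M N : Type*} [TopologicalSpace M] [ChartedSpace H M] [TopologicalSpace N] [ChartedSpace H' N]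
    (ψ : M → N) (p : M) : E →L[ℝ] E' := mfderiv I J ψ p

/-- The pullback `ψ^* g` of a field of bilinear forms. -/
def pullback (I : ModelWithCorners ℝ E H) (J : ModelWithCorners ℝ E' H')
    {M N : Type*} [TopologicalSpace M] [ChartedSpace H M] [TopologicalSpace N] [ChartedSpace H' N]
    (ψ : M → N) (g : FormField J N) : FormField I M :=
  fun p => (g (ψ p)).bilinearComp (differential I J ψ p) (differential I J ψ p)

/-- The coordinate expression of `g` in the preferred chart at `x₀`: at the point with coordinates
`y` it is the bilinear form whose value on `u, v` is `g (dα u, dα v)`, where `α` is the inverse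
chart, i.e. the form with components `g_{ij}(y)`. -/
def chartForm (J : ModelWithCorners ℝ E' H') {N : Type*} [TopologicalSpace N] [ChartedSpace H' N]
    (g : FormField J N) (x₀ : N) : E' → E' →L[ℝ] E' →L[ℝ] ℝ :=
  pullback 𝓘(ℝ, E') J (extChartAt J x₀).symm g

/-- The Christoffel symbols of the second kind of `g`, in the preferred chart at `x₀`, at the point
with coordinates `y`: the vector `Γ(u, v)` is characterised by
`2 g(Γ(u, v), w) = ∂_u g(v, w) + ∂_v g(u, w) - ∂_w g(u, v)` for all `w`. -/
def christoffel (J : ModelWithCorners ℝ E' H') {N : Type*} [TopologicalSpace N] [ChartedSpace H' N]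
    (g : FormField J N) (x₀ : N) (y u v : E') : E' :=
  let G : E' → E' →L[ℝ] E' →L[ℝ] ℝ := chartForm J g x₀
  let DG : E' →L[ℝ] E' →L[ℝ] E' →L[ℝ] ℝ := fderiv ℝ G y
  (G y).inverse ((1 / 2 : ℝ) • (DG u v + DG v u - (DG.flip u).flip v))

/-- The Levi-Civita covariant derivative `∇_u v` of `N` along `ψ : M → N` at `p`, where `u, v` also
denote the coordinate vector fields on `M` with constant components `u, v` in the preferred chart
at `p`, and `v` is pushed forward to a vector field along `ψ`.  In coordinates it is
`∂_u ∂_v ψ + Γ(∂_u ψ, ∂_v ψ)`. -/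
def covDerivAlong (I : ModelWithCorners ℝ E H) (J : ModelWithCorners ℝ E' H')
    {M N : Type*} [TopologicalSpace M] [ChartedSpace H M] [TopologicalSpace N] [ChartedSpace H' N]
    (g : FormField J N) (ψ : M → N) (p : M) (u v : E) : E' :=
  let ψc : E → E' := writtenInExtChartAt I J p ψ
  let y : E := extChartAt I p p
  fderiv ℝ (fderiv ℝ ψc) y u v +
    christoffel J g (ψ p) (ψc y) (fderiv ℝ ψc y u) (fderiv ℝ ψc y v)

/-- The tangential component, as an element of `T_p M`, of a vector `a` of `T_{ψ p} N`: the vector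
`w` with `g(dψ w, dψ z) = g(a, dψ z)` for all `z` in `T_p M`. -/
def tangentPart (I : ModelWithCorners ℝ E H) (J : ModelWithCorners ℝ E' H')
    {M N : Type*} [TopologicalSpace M] [ChartedSpace H M] [TopologicalSpace N] [ChartedSpace H' N]
    (g : FormField J N) (ψ : M → N) (p : M) (a : E') : E :=
  (pullback I J ψ g p).inverse ((g (ψ p) a).comp (differential I J ψ p))

/-- The normal component `a^⊥` of a vector `a` of `T_{ψ p} N`. -/
def normalPart (I : ModelWithCorners ℝ E H) (J : ModelWithCorners ℝ E' H')
    {M N : Type*} [TopologicalSpace M] [ChartedSpace H M] [TopologicalSpace N] [ChartedSpace H' N]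
    (g : FormField J N) (ψ : M → N) (p : M) (a : E') : E' :=
  a - differential I J ψ p (tangentPart I J g ψ p a)

/-- The second fundamental form, with the sign convention `II(u, v) = -(∇_u v)^⊥`. -/
def secondFundamentalForm (I : ModelWithCorners ℝ E H) (J : ModelWithCorners ℝ E' H')
    {M N : Type*} [TopologicalSpace M] [ChartedSpace H M] [TopologicalSpace N] [ChartedSpace H' N]
    (g : FormField J N) (ψ : M → N) (p : M) (u v : E) : E' :=
  -normalPart I J g ψ p (covDerivAlong I J g ψ p u v)

/-- The Hessian `∇²u` of a function with respect to `g`, at `p`; in coordinates it is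
`∂_v ∂_w u - du(Γ(v, w))`. -/
def hessian (I : ModelWithCorners ℝ E H) {M : Type*} [TopologicalSpace M] [ChartedSpace H M]
    (g : FormField I M) (u : M → ℝ) (p : M) (v w : E) : ℝ :=
  let uc : E → ℝ := u ∘ (extChartAt I p).symm
  let y : E := extChartAt I p p
  fderiv ℝ (fderiv ℝ uc) y v w - fderiv ℝ uc y (christoffel I g p y v w)

end General

/-- The trace `∑ g^{ij} B(e_i, e_j)` of a (vector-valued) bilinear map `B` with respect to the
bilinear form `g`. -/
def metricTrace {k : ℕ} {W : Type*} [AddCommGroup W] [Module ℝ W]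
    (g : EuclideanSpace ℝ (Fin k) →L[ℝ] EuclideanSpace ℝ (Fin k) →L[ℝ] ℝ)
    (B : EuclideanSpace ℝ (Fin k) → EuclideanSpace ℝ (Fin k) → W) : W :=
  let e : Fin k → EuclideanSpace ℝ (Fin k) := fun i => EuclideanSpace.single i 1
  let gram : Matrix (Fin k) (Fin k) ℝ := Matrix.of fun i j => g (e i) (e j)
  ∑ i, ∑ j, gram⁻¹ i j • B (e i) (e j)

section Submanifold

variable (k : ℕ) {M : Type*} [TopologicalSpace M] [ChartedSpace (EuclideanSpace ℝ (Fin k)) M]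

/-- The Laplace-Beltrami operator `Δ_g u = tr_g ∇²u`. -/
def laplacian (g : FormField (𝓡 k) M) (u : M → ℝ) (p : M) : ℝ :=
  metricTrace (g p) (hessian (𝓡 k) g u p)

/-- `(M, g)` is parabolic: every superharmonic function (of class `C²`, with `Δ_g u ≤ 0`) bounded
from below is constant.  Closed manifolds are included. -/
def IsParabolic (g : FormField (𝓡 k) M) : Prop :=
  ∀ u : M → ℝ, ContMDiff (𝓡 k) 𝓘(ℝ, ℝ) 2 u → (∀ p, laplacian k g u p ≤ 0) →
    BddBelow (Set.range u) → ∃ c : ℝ, ∀ p, u p = c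

/-- The mean curvature vector `(1 / k) trace II` of `ψ : M → (N, g)`, the trace being taken with
respect to the induced metric. -/
def meanCurvature {E' : Type*} [NormedAddCommGroup E'] [NormedSpace ℝ E']
    {H' : Type*} [TopologicalSpace H'] (J : ModelWithCorners ℝ E' H')
    {N : Type*} [TopologicalSpace N] [ChartedSpace H' N]
    (g : FormField J N) (ψ : M → N) (p : M) : E' :=
  (1 / (k : ℝ)) •
    metricTrace (pullback (𝓡 k) J ψ g p) (secondFundamentalForm (𝓡 k) J g ψ p)

end Submanifold

section Product

variable {m : ℕ} {F : Type*} [TopologicalSpace F] [ChartedSpace (EuclideanSpace ℝ (Fin m)) F]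
  [IsManifold (𝓡 m) ∞ F]

/-- A smooth Riemannian metric on `F`. -/
abbrev RiemannianMetricOn (m : ℕ) (F : Type*) [TopologicalSpace F]
    [ChartedSpace (EuclideanSpace ℝ (Fin m)) F] [IsManifold (𝓡 m) ∞ F] : Type _ :=
  Bundle.ContMDiffRiemannianMetric (𝓡 m) ∞ (EuclideanSpace ℝ (Fin m))
    (TangentSpace (𝓡 m) : F → Type _)

/-- The Riemannian metric of `F` as a field of bilinear forms. -/
def fiberMetric (gF : RiemannianMetricOn m F) : FormField (𝓡 m) F := fun x => gF.inner x

/-- The model of the product manifold `ℝ × F`. -/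
abbrev prodModel (m : ℕ) :
    ModelWithCorners ℝ (ℝ × EuclideanSpace ℝ (Fin m)) (ModelProd ℝ (EuclideanSpace ℝ (Fin m))) :=
  𝓘(ℝ, ℝ).prod (𝓡 m)

/-- The metric `dt²` of the real line. -/
def lineMetric : FormField 𝓘(ℝ, ℝ) ℝ := fun _ => ContinuousLinearMap.mul ℝ ℝ

/-- The Lorentzian product metric `-π_ℝ^*(dt²) + π_F^*(g_F)` on `ℝ × F`. -/
def lorentzMetric (gF : RiemannianMetricOn m F) : FormField (prodModel m) (ℝ × F) :=
  fun x => -pullback (prodModel m) 𝓘(ℝ, ℝ) Prod.fst lineMetric x +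
    pullback (prodModel m) (𝓡 m) Prod.snd (fiberMetric gF) x

/-- The vector `∂_t`, at any point of `ℝ × F`; it defines the time orientation. -/
def timeVector (m : ℕ) : ℝ × EuclideanSpace ℝ (Fin m) := (1, 0)

/-- A tangent vector at `x` is causal (timelike or lightlike). -/
def IsCausal (gF : RiemannianMetricOn m F) (x : ℝ × F) (v : ℝ × EuclideanSpace ℝ (Fin m)) : Prop :=
  v ≠ 0 ∧ lorentzMetric gF x v v ≤ 0

/-- A causal vector is future pointing when `g(v, ∂_t) < 0`. -/
def IsFutureCausal (gF : RiemannianMetricOn m F) (x : ℝ × F)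
    (v : ℝ × EuclideanSpace ℝ (Fin m)) : Prop :=
  IsCausal gF x v ∧ lorentzMetric gF x v (timeVector m) < 0

/-- A causal vector is past pointing when `g(v, ∂_t) > 0`. -/
def IsPastCausal (gF : RiemannianMetricOn m F) (x : ℝ × F)
    (v : ℝ × EuclideanSpace ℝ (Fin m)) : Prop :=
  IsCausal gF x v ∧ 0 < lorentzMetric gF x v (timeVector m)

variable (k : ℕ) {M : Type*} [TopologicalSpace M] [ChartedSpace (EuclideanSpace ℝ (Fin k)) M]

/-- The metric induced on `M` by `ψ : M → ℝ × F`. -/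
def inducedMetric (gF : RiemannianMetricOn m F) (ψ : M → ℝ × F) : FormField (𝓡 k) M :=
  pullback (𝓡 k) (prodModel m) ψ (lorentzMetric gF)

/-- `ψ` is a smooth spacelike immersion: the induced metric is Riemannian.  (Positive definiteness
already forces the differential to be injective.) -/
structure IsSpacelikeImmersion (gF : RiemannianMetricOn m F) (ψ : M → ℝ × F) : Prop where
  smooth : ContMDiff (𝓡 k) (prodModel m) ∞ ψ
  injective_differential : ∀ p, Function.Injective (differential (𝓡 k) (prodModel m) ψ p)
  posDef : ∀ (p : M) (v : EuclideanSpace ℝ (Fin k)), v ≠ 0 → 0 < inducedMetric k gF ψ p v v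

/-- The mean curvature vector of `ψ` in the Lorentzian product. -/
def meanCurvatureVector (gF : RiemannianMetricOn m F) (ψ : M → ℝ × F) (p : M) :
    ℝ × EuclideanSpace ℝ (Fin m) :=
  meanCurvature k (prodModel m) (lorentzMetric gF) ψ p

/-- Weakly future trapped, or weakly past trapped. -/
def IsWeaklyTrapped (gF : RiemannianMetricOn m F) (ψ : M → ℝ × F) : Prop :=
  (∀ p, IsFutureCausal gF (ψ p) (meanCurvatureVector k gF ψ p)) ∨
    (∀ p, IsPastCausal gF (ψ p) (meanCurvatureVector k gF ψ p))

/-- Extremal: the mean curvature vector vanishes. -/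
def IsExtremal (gF : RiemannianMetricOn m F) (ψ : M → ℝ × F) : Prop :=
  ∀ p, meanCurvatureVector k gF ψ p = 0

/-- `ψ(M)` lies between two spacelike slices. -/
def InSlab {M F : Type*} (ψ : M → ℝ × F) : Prop :=
  ∃ a b : ℝ, ∀ p, a ≤ (ψ p).1 ∧ (ψ p).1 ≤ b

/-- The height function is bounded from above. -/
def BoundedAwayFromFutureInfinity {M F : Type*} (ψ : M → ℝ × F) : Prop :=
  ∃ b : ℝ, ∀ p, (ψ p).1 ≤ b

/-- The height function is bounded from below. -/
def BoundedAwayFromPastInfinity {M F : Type*} (ψ : M → ℝ × F) : Prop :=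
  ∃ a : ℝ, ∀ p, a ≤ (ψ p).1

/-- `ψ` is a minimal submanifold of a spacelike slice: `ψ(M) ⊆ {t₀} × F` for some `t₀`, and the
immersion `π_F ∘ ψ` into the slice, on which the induced metric is `g_F`, has zero mean curvature
vector. -/
def IsMinimalInSlice (gF : RiemannianMetricOn m F) (ψ : M → ℝ × F) : Prop :=
  ∃ t₀ : ℝ, (∀ p, (ψ p).1 = t₀) ∧
    ∀ p, meanCurvature k (𝓡 m) (fiberMetric gF) (fun q => (ψ q).2) p = 0

end Product

end LorentzProduct

end

/-! Since `∂_t` is parallel, the time component of the Gauss formula says that the Hessian of the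
height function `τ` is minus the time component of `II`, so that `Δτ = -k H_t`. If `H` is causal,
then `H_t` has a strict sign, and parabolicity applied to `τ` or `-τ` contradicts a one-sided bound
on the height. If `H = 0`, then `τ` is harmonic, hence constant as soon as it is bounded on one
side; within a slice `H_t = 0`, and the `F`-component of `H` is the mean curvature vector of
`π_F ∘ ψ`. -/

namespace LorentzProduct

open Filter
open scoped Topology

section VectorSpace

variable {V W : Type*} [NormedAddCommGroup V] [NormedSpace ℝ V] [NormedAddCommGroup W]
  [NormedSpace ℝ W]

theorem isInvertible_of_apply_self_pos [FiniteDimensional ℝ V] {B : V →L[ℝ] V →L[ℝ] ℝ}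
    (hB : ∀ v, v ≠ 0 → 0 < B v v) : B.IsInvertible := by
  have hinj : Function.Injective (B : V →ₗ[ℝ] V →L[ℝ] ℝ) := by
    refine (injective_iff_map_eq_zero _).2 fun v hv => ?_
    by_contra hne
    have hv' : B v = 0 := hv
    exact (hB v hne).ne' (by rw [hv', zero_apply])
  have hdim : Module.finrank ℝ V = Module.finrank ℝ (V →L[ℝ] ℝ) := by
    rw [← (LinearMap.toContinuousLinearMap (𝕜 := ℝ) (E := V) (F' := ℝ)).finrank_eq]
    exact Subspace.dual_finrank_eq.symm
  exact ⟨(LinearEquiv.ofInjectiveOfFinrankEq _ hinj hdim).toContinuousLinearEquiv, rfl⟩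

theorem isInvertible_neg_mul : (-ContinuousLinearMap.mul ℝ ℝ).IsInvertible := by
  have h : (ContinuousLinearMap.mul ℝ ℝ).IsInvertible :=
    isInvertible_of_apply_self_pos fun a ha => by simpa using mul_self_pos.2 ha
  obtain ⟨e, he⟩ := h
  exact ⟨e.trans (.neg ℝ), by rw [← he]; rfl⟩

theorem isInvertible_bilinearComp_fst_add_snd {B : V →L[ℝ] V →L[ℝ] ℝ} {C : W →L[ℝ] W →L[ℝ] ℝ}
    (hB : B.IsInvertible) (hC : C.IsInvertible) :
    (B.bilinearComp (.fst ℝ V W) (.fst ℝ V W) +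
      C.bilinearComp (.snd ℝ V W) (.snd ℝ V W)).IsInvertible := by
  obtain ⟨b, rfl⟩ := hB
  obtain ⟨c, rfl⟩ := hC
  refine ⟨(b.prodCongr c).trans (ContinuousLinearMap.coprodEquivL ℝ), ?_⟩
  ext <;> simp

variable {X : Type*} [NormedAddCommGroup X] [NormedSpace ℝ X] {x : X}

theorem differentiableAt_clm_flip {U : Type*} [NormedAddCommGroup U] [NormedSpace ℝ U]
    {A : X → V →L[ℝ] W →L[ℝ] U} (hA : DifferentiableAt ℝ A x) :
    DifferentiableAt ℝ (fun z => (A z).flip) x := by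
  have hflip : IsBoundedLinearMap ℝ (ContinuousLinearMap.flip : (V →L[ℝ] W →L[ℝ] U) → _) :=
    ⟨⟨fun _ _ => rfl, fun _ _ => rfl⟩, 1, one_pos, fun f => by simp⟩
  exact DifferentiableAt.comp (𝕜 := ℝ) (f := A) (g := ContinuousLinearMap.flip) x
    hflip.differentiableAt hA

theorem hasFDerivAt_fderiv_apply {f : X → V} (hf : ContDiffAt ℝ 2 f x) (v : X) :
    HasFDerivAt (fun z => fderiv ℝ f z v) ((fderiv ℝ (fderiv ℝ f) x).flip v) x := by
  have hdf : DifferentiableAt ℝ (fderiv ℝ f) x :=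
    (hf.fderiv_right (m := 1) (by norm_num)).differentiableAt (by norm_num)
  simpa using hdf.hasFDerivAt.clm_apply (hasFDerivAt_const v x)

theorem fderiv_fderiv_prodMk {f₁ : X → V} {f₂ : X → W}
    (hf₁ : ContDiffAt ℝ 2 f₁ x) (hf₂ : ContDiffAt ℝ 2 f₂ x) (u v : X) :
    fderiv ℝ (fderiv ℝ fun z => (f₁ z, f₂ z)) x u v =
      (fderiv ℝ (fderiv ℝ f₁) x u v, fderiv ℝ (fderiv ℝ f₂) x u v) := by
  have hdf : (fun z => fderiv ℝ (fun z => (f₁ z, f₂ z)) z v) =ᶠ[𝓝 x]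
      fun z => (fderiv ℝ f₁ z v, fderiv ℝ f₂ z v) := by
    filter_upwards [hf₁.eventually (by simp), hf₂.eventually (by simp)] with z hz₁ hz₂
    rw [(hz₁.differentiableAt (by simp)).fderiv_prodMk (hz₂.differentiableAt (by simp)),
      ContinuousLinearMap.prod_apply]
  have h := (hasFDerivAt_fderiv_apply (hf₁.prodMk hf₂) v).unique <|
    ((hasFDerivAt_fderiv_apply hf₁ v).prodMk
      (hasFDerivAt_fderiv_apply hf₂ v)).congr_of_eventuallyEq hdf
  exact DFunLike.congr_fun h u

variable {A : X → W →L[ℝ] W →L[ℝ] ℝ} {B C : X → V →L[ℝ] W}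

theorem differentiableAt_bilinearComp (hA : DifferentiableAt ℝ A x)
    (hB : DifferentiableAt ℝ B x) (hC : DifferentiableAt ℝ C x) :
    DifferentiableAt ℝ (fun z => (A z).bilinearComp (B z) (C z)) x :=
  differentiableAt_clm_flip ((differentiableAt_clm_flip (hA.clm_comp hB)).clm_comp hC)

theorem fderiv_bilinearComp (hA : DifferentiableAt ℝ A x)
    (hB : DifferentiableAt ℝ B x) (hC : DifferentiableAt ℝ C x) (a : X) (u v : V) :
    fderiv ℝ (fun z => (A z).bilinearComp (B z) (C z)) x a u v =
      fderiv ℝ A x a (B x u) (C x v) + A x (fderiv ℝ B x a u) (C x v) +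
        A x (B x u) (fderiv ℝ C x a v) := by
  have h := differentiableAt_bilinearComp hA hB hC
  have hBu : DifferentiableAt ℝ (fun z => B z u) x := hB.clm_apply (differentiableAt_const u)
  have hCv : DifferentiableAt ℝ (fun z => C z v) x := hC.clm_apply (differentiableAt_const v)
  calc fderiv ℝ (fun z => (A z).bilinearComp (B z) (C z)) x a u v
      = fderiv ℝ (fun z => (A z).bilinearComp (B z) (C z) u v) x a := by
        rw [fderiv_clm_apply (h.clm_apply (differentiableAt_const u)) (differentiableAt_const v),
          fderiv_clm_apply h (differentiableAt_const u)]
        simp only [fderiv_fun_const, Pi.zero_apply, ContinuousLinearMap.comp_zero, zero_add,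
          ContinuousLinearMap.flip_apply]
    _ = fderiv ℝ (fun z => A z (B z u) (C z v)) x a := rfl
    _ = _ := by
        rw [fderiv_clm_apply (hA.clm_apply hBu) hCv, fderiv_clm_apply hA hBu,
          fderiv_clm_apply hB (differentiableAt_const u),
          fderiv_clm_apply hC (differentiableAt_const v)]
        simp only [fderiv_fun_const, Pi.zero_apply, ContinuousLinearMap.comp_zero, zero_add,
          ContinuousLinearMap.flip_add, add_apply, ContinuousLinearMap.comp_apply,
          ContinuousLinearMap.flip_apply]
        ring

/-- The Christoffel symbols of the first kind `Γ(u, v; w)` at `y` of the field of bilinear forms `G`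
on a vector space, so that `G(Γ(u, v), w) = Γ(u, v; w)`. -/
noncomputable def christoffelFirst (G : V → V →L[ℝ] V →L[ℝ] ℝ) (y u v w : V) : ℝ :=
  1 / 2 * (fderiv ℝ G y u v w + fderiv ℝ G y v u w - fderiv ℝ G y w u v)

theorem christoffelFirst_add {G G' : V → V →L[ℝ] V →L[ℝ] ℝ} {y : V} (hG : DifferentiableAt ℝ G y)
    (hG' : DifferentiableAt ℝ G' y) (u v w : V) :
    christoffelFirst (G + G') y u v w =
      christoffelFirst G y u v w + christoffelFirst G' y u v w := by
  have h : fderiv ℝ (G + G') y = fderiv ℝ G y + fderiv ℝ G' y :=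
    fderiv_add (𝕜 := ℝ) (f := G) (g := G') hG hG'
  simp only [christoffelFirst, h, add_apply]
  ring

theorem christoffelFirst_bilinearComp_fderiv {G : W → W →L[ℝ] W →L[ℝ] ℝ} {f : V → W} {y : V}
    (hf : ContDiffAt ℝ 2 f y) (hG : DifferentiableAt ℝ G (f y))
    (hsymm : ∀ a b, G (f y) a b = G (f y) b a) (u v w : V) :
    christoffelFirst (fun z => (G (f z)).bilinearComp (fderiv ℝ f z) (fderiv ℝ f z)) y u v w =
      christoffelFirst G (f y) (fderiv ℝ f y u) (fderiv ℝ f y v) (fderiv ℝ f y w) +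
        G (f y) (fderiv ℝ (fderiv ℝ f) y u v) (fderiv ℝ f y w) := by
  have hdf : DifferentiableAt ℝ (fderiv ℝ f) y :=
    (hf.fderiv_right (m := 1) (by norm_num)).differentiableAt (by norm_num)
  have hfy : DifferentiableAt ℝ f y := hf.differentiableAt (by norm_num)
  have hGf : fderiv ℝ (fun z => G (f z)) y = (fderiv ℝ G (f y)).comp (fderiv ℝ f y) :=
    fderiv_fun_comp (g := G) y hG hfy
  have hGfy : DifferentiableAt ℝ (fun z => G (f z)) y :=
    DifferentiableAt.comp (g := G) y hG hfy
  have hs (a b : V) : fderiv ℝ (fderiv ℝ f) y a b = fderiv ℝ (fderiv ℝ f) y b a :=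
    (hf.isSymmSndFDerivAt (by simp)).eq a b
  simp only [christoffelFirst, fderiv_bilinearComp hGfy hdf hdf, hGf,
    ContinuousLinearMap.comp_apply]
  rw [hs v u, hs w u, hs w v, hsymm (fderiv ℝ f y v), hsymm (fderiv ℝ f y u)]
  ring

end VectorSpace

section Charts

variable {E : Type*} [NormedAddCommGroup E] [NormedSpace ℝ E]
  {H : Type*} [TopologicalSpace H] {I : ModelWithCorners ℝ E H}
  {E' : Type*} [NormedAddCommGroup E'] [NormedSpace ℝ E']
  {H' : Type*} [TopologicalSpace H'] {J : ModelWithCorners ℝ E' H'}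
  {M : Type*} [TopologicalSpace M] [ChartedSpace H M]
  {N : Type*} [TopologicalSpace N] [ChartedSpace H' N]

theorem pullback_comp {E'' : Type*} [NormedAddCommGroup E''] [NormedSpace ℝ E'']
    {H'' : Type*} [TopologicalSpace H''] {K : ModelWithCorners ℝ E'' H''}
    {P : Type*} [TopologicalSpace P] [ChartedSpace H'' P] {f : N → P} {ψ : M → N} {p : M}
    (g : FormField K P) (hf : MDifferentiableAt J K f (ψ p)) (hψ : MDifferentiableAt I J ψ p) :
    pullback I K (f ∘ ψ) g p = pullback I J ψ (pullback J K f g) p := by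
  have h : differential I K (f ∘ ψ) p = (differential J K f (ψ p)).comp (differential I J ψ p) :=
    mfderiv_comp p hf hψ
  ext u v
  simp [pullback, h]

theorem pullback_congr {φ ψ : M → N} {p : M} (h : φ =ᶠ[𝓝 p] ψ)
    (g : FormField J N) : pullback I J φ g p = pullback I J ψ g p := by
  have hd : differential I J φ p = differential I J ψ p := h.mfderiv_eq
  simp only [pullback, hd, h.self_of_nhds]

theorem differential_eq_fderiv [I.Boundaryless] {ψ : M → N} {p : M}
    (hψ : MDifferentiableAt I J ψ p) :
    differential I J ψ p = fderiv ℝ (writtenInExtChartAt I J p ψ) (extChartAt I p p) := by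
  simp [differential, mfderiv, hψ, I.range_eq_univ]

theorem contDiffAt_writtenInExtChartAt [I.Boundaryless] {n : WithTop ℕ∞} {ψ : M → N} {p : M}
    (hψ : ContMDiffAt I J n ψ p) :
    ContDiffAt ℝ n (writtenInExtChartAt I J p ψ) (extChartAt I p p) := by
  have h := (contMDiffAt_iff.1 hψ).2
  rwa [I.range_eq_univ, contDiffWithinAt_univ] at h

theorem writtenInExtChartAt_self (ψ : M → N) (p : M) :
    writtenInExtChartAt I J p ψ (extChartAt I p p) = extChartAt J (ψ p) (ψ p) := by
  simp [writtenInExtChartAt]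

theorem chartForm_add (g g' : FormField J N) (x : N) :
    chartForm J (g + g') x = chartForm J g x + chartForm J g' x := rfl

theorem covDerivAlong_eq_christoffel (g : FormField J N) {ψ : M → N} {p : M} {L : E →L[ℝ] E'}
    (hψ : writtenInExtChartAt I J p ψ =ᶠ[𝓝 (extChartAt I p p)] L) (u v : E) :
    covDerivAlong I J g ψ p u v =
      christoffel J g (ψ p) (extChartAt J (ψ p) (ψ p)) (L u) (L v) := by
  have hd : fderiv ℝ (writtenInExtChartAt I J p ψ) =ᶠ[𝓝 (extChartAt I p p)] fun _ => L := by
    simpa only [EventuallyEq, L.fderiv] using hψ.fderiv (𝕜 := ℝ)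
  simp only [covDerivAlong, writtenInExtChartAt_self, hd.fderiv_eq, hd.self_of_nhds,
    fderiv_fun_const, Pi.zero_apply, zero_apply, zero_add]

variable [J.Boundaryless] [IsManifold J 1 N]

theorem mdifferentiableAt_extChartAt_symm {x : N} {y : E'} (hy : y ∈ (extChartAt J x).target) :
    MDifferentiableAt 𝓘(ℝ, E') J (extChartAt J x).symm y := by
  have h := mdifferentiableWithinAt_extChartAt_symm hy
  rwa [J.range_eq_univ, mdifferentiableWithinAt_univ] at h

theorem chartForm_self (g : FormField J N) (x : N) :
    chartForm J g x (extChartAt J x x) = g x := by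
  have h : differential 𝓘(ℝ, E') J (extChartAt J x).symm (extChartAt J x x) =
      ContinuousLinearMap.id ℝ E' := by
    have h' := mfderivWithin_range_extChartAt_symm (I := J) (x := x)
    rwa [J.range_eq_univ, mfderivWithin_univ] at h'
  rw [chartForm, pullback, h, extChartAt_to_inv]
  rfl

theorem trivializationAt_symm_apply {x : N} {y : E'} (hy : y ∈ (extChartAt J x).target) (v : E') :
    (trivializationAt E' (TangentSpace J) x).symm ((extChartAt J x).symm y) v =
      differential 𝓘(ℝ, E') J (extChartAt J x).symm y v := by
  have hs : (extChartAt J x).symm y ∈ (chartAt H' x).source := by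
    simpa only [extChartAt_source] using (extChartAt J x).map_target hy
  have h := TangentBundle.symmL_trivializationAt (I := J) hs
  rw [(extChartAt J x).right_inv hy, J.range_eq_univ, mfderivWithin_univ] at h
  rw [differential, ← h]
  exact (Bundle.Trivialization.symmL_apply _ hs v).symm

theorem chartForm_eq_inCoordinates (g : FormField J N) {x : N} {y : E'}
    (hy : y ∈ (extChartAt J x).target) :
    chartForm J g x y =
      ContinuousLinearMap.inCoordinates E' (TangentSpace J) (E' →L[ℝ] ℝ)
        (fun z => TangentSpace J z →L[ℝ] ℝ) x ((extChartAt J x).symm y) x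
        ((extChartAt J x).symm y) (g ((extChartAt J x).symm y)) := by
  have hs : (extChartAt J x).symm y ∈ (chartAt H' x).source := by
    simpa only [extChartAt_source] using (extChartAt J x).map_target hy
  ext u v
  refine Eq.trans ?_ (inCoordinates_apply_eq₂ (E₃ := fun _ => ℝ) hs hs (by simp)).symm
  rw [trivializationAt_symm_apply hy, trivializationAt_symm_apply hy]
  simp only [Bundle.Trivial.fiberBundle_trivializationAt',
    Bundle.Trivial.linearMapAt_trivialization, LinearMap.id_coe, id_eq]
  rfl

theorem differentiableAt_chartForm {g : FormField J N} {x : N}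
    (hg : ContMDiffAt J (J.prod 𝓘(ℝ, E' →L[ℝ] E' →L[ℝ] ℝ)) 1
      (fun z => Bundle.TotalSpace.mk' (E' →L[ℝ] E' →L[ℝ] ℝ)
        (E := fun z => TangentSpace J z →L[ℝ] TangentSpace J z →L[ℝ] ℝ) z (g z)) x) :
    DifferentiableAt ℝ (chartForm J g x) (extChartAt J x x) := by
  have hsymm : ContMDiffAt 𝓘(ℝ, E') J 1 (extChartAt J x).symm (extChartAt J x x) :=
    (contMDiffOn_extChartAt_symm x).contMDiffAt (extChartAt_target_mem_nhds x)
  have hcoord := ((contMDiffAt_hom_bundle _).1 hg).2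
  rw [← extChartAt_to_inv (I := J) x] at hcoord
  have h := (hcoord.comp (extChartAt J x x) hsymm).contDiffAt.differentiableAt one_ne_zero
  refine h.congr_of_eventuallyEq ?_
  filter_upwards [extChartAt_target_mem_nhds (I := J) x] with y hy
  simpa using chartForm_eq_inCoordinates g hy

/-- The field of bilinear forms `g` is a semi-Riemannian metric to first order at `x`: it is
symmetric and nondegenerate there, and its components in the preferred chart are differentiable. -/
structure IsSemiRiemannianAt (J : ModelWithCorners ℝ E' H') (g : FormField J N) (x : N) :
    Prop where
  symm : ∀ a b, g x a b = g x b a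
  isInvertible : (g x).IsInvertible
  differentiableAt_chartForm : DifferentiableAt ℝ (chartForm J g x) (extChartAt J x x)

theorem apply_christoffel {g : FormField J N} {x : N} (hg : (g x).IsInvertible) (u v w : E') :
    g x (christoffel J g x (extChartAt J x x) u v) w =
      christoffelFirst (chartForm J g x) (extChartAt J x x) u v w := by
  simp only [christoffel, chartForm_self, hg.self_apply_inverse]
  simp [christoffelFirst]

theorem eq_christoffel {g : FormField J N} {x : N} (hg : (g x).IsInvertible) {u v c : E'}
    (hc : ∀ w, g x c w = christoffelFirst (chartForm J g x) (extChartAt J x x) u v w) :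
    c = christoffel J g x (extChartAt J x x) u v :=
  hg.injective <| ContinuousLinearMap.ext fun w => (hc w).trans (apply_christoffel hg u v w).symm

variable [I.Boundaryless] [IsManifold I 1 M] {g : FormField J N} {ψ : M → N} {p : M}

theorem chartForm_pullback (g : FormField J N) (hψ : ContMDiffAt I J 1 ψ p) :
    chartForm I (pullback I J ψ g) p =ᶠ[𝓝 (extChartAt I p p)] fun y =>
      (chartForm J g (ψ p) (writtenInExtChartAt I J p ψ y)).bilinearComp
        (fderiv ℝ (writtenInExtChartAt I J p ψ) y) (fderiv ℝ (writtenInExtChartAt I J p ψ) y) := by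
  have hsymm : Tendsto (extChartAt I p).symm (𝓝 (extChartAt I p p)) (𝓝 p) := by
    simpa only [ContinuousAt, extChartAt_to_inv] using continuousAt_extChartAt_symm (I := I) p
  have hψd : ∀ᶠ y in 𝓝 (extChartAt I p p), MDifferentiableAt I J ψ ((extChartAt I p).symm y) :=
    (hsymm.eventually ((contMDiffAt_iff_contMDiffAt_nhds (by simp)).1 hψ)).mono
      fun y hy => hy.mdifferentiableAt (by simp)
  have hsrc : ∀ᶠ y in 𝓝 (extChartAt I p p),
      ψ ((extChartAt I p).symm y) ∈ (extChartAt J (ψ p)).source :=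
    hsymm.eventually (hψ.continuousAt.eventually_mem (extChartAt_source_mem_nhds (I := J) (ψ p)))
  have hd : ∀ᶠ y in 𝓝 (extChartAt I p p), DifferentiableAt ℝ (writtenInExtChartAt I J p ψ) y :=
    ((contDiffAt_writtenInExtChartAt hψ).eventually (by simp)).mono
      fun y hy => hy.differentiableAt (by simp)
  filter_upwards [hψd, hsrc.eventually_nhds, hd, extChartAt_target_mem_nhds (I := I) p]
    with y hψy hy hdy hty
  have hchart : ψ ∘ (extChartAt I p).symm =ᶠ[𝓝 y]
      (extChartAt J (ψ p)).symm ∘ writtenInExtChartAt I J p ψ := by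
    filter_upwards [hy] with z hz using ((extChartAt J (ψ p)).left_inv hz).symm
  have hyt : writtenInExtChartAt I J p ψ y ∈ (extChartAt J (ψ p)).target :=
    (extChartAt J (ψ p)).map_source hy.self_of_nhds
  calc chartForm I (pullback I J ψ g) p y
      = pullback 𝓘(ℝ, E) J (ψ ∘ (extChartAt I p).symm) g y :=
        (pullback_comp g hψy (mdifferentiableAt_extChartAt_symm hty)).symm
    _ = pullback 𝓘(ℝ, E) J ((extChartAt J (ψ p)).symm ∘ writtenInExtChartAt I J p ψ) g y :=
        pullback_congr hchart g
    _ = pullback 𝓘(ℝ, E) 𝓘(ℝ, E') (writtenInExtChartAt I J p ψ) (chartForm J g (ψ p)) y :=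
        pullback_comp g (mdifferentiableAt_extChartAt_symm hyt) hdy.mdifferentiableAt
    _ = _ := by simp only [pullback, differential, mfderiv_eq_fderiv]

theorem differentiableAt_chartForm_pullback (hψ : ContMDiffAt I J 2 ψ p)
    (hg : DifferentiableAt ℝ (chartForm J g (ψ p)) (extChartAt J (ψ p) (ψ p))) :
    DifferentiableAt ℝ (chartForm I (pullback I J ψ g) p) (extChartAt I p p) := by
  have hf := contDiffAt_writtenInExtChartAt hψ
  have hdf : DifferentiableAt ℝ (fderiv ℝ (writtenInExtChartAt I J p ψ)) (extChartAt I p p) :=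
    (hf.fderiv_right (m := 1) (by norm_num)).differentiableAt (by norm_num)
  have hG : DifferentiableAt ℝ (fun y => chartForm J g (ψ p) (writtenInExtChartAt I J p ψ y))
      (extChartAt I p p) :=
    DifferentiableAt.comp (g := chartForm J g (ψ p)) _ (by rwa [writtenInExtChartAt_self])
      (hf.differentiableAt (by norm_num))
  exact (differentiableAt_bilinearComp hG hdf hdf).congr_of_eventuallyEq
    (chartForm_pullback g (hψ.of_le (by norm_num)))

theorem christoffelFirst_chartForm_pullback (hψ : ContMDiffAt I J 2 ψ p)
    (hg : IsSemiRiemannianAt J g (ψ p)) (u v w : E) :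
    christoffelFirst (chartForm I (pullback I J ψ g) p) (extChartAt I p p) u v w =
      g (ψ p) (covDerivAlong I J g ψ p u v) (differential I J ψ p w) := by
  have hchart := (chartForm_pullback g (hψ.of_le (by norm_num))).fderiv_eq (𝕜 := ℝ)
  have htransform := christoffelFirst_bilinearComp_fderiv (G := chartForm J g (ψ p))
    (contDiffAt_writtenInExtChartAt hψ)
    (by rw [writtenInExtChartAt_self]; exact hg.differentiableAt_chartForm)
    (by rw [writtenInExtChartAt_self, chartForm_self]; exact hg.symm) u v w
  rw [writtenInExtChartAt_self, chartForm_self, ← apply_christoffel hg.isInvertible] at htransform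
  rw [christoffelFirst, hchart, ← christoffelFirst, htransform, covDerivAlong,
    writtenInExtChartAt_self, differential_eq_fderiv (hψ.mdifferentiableAt (by norm_num)), map_add,
    add_apply, add_comm]

theorem tangentPart_covDerivAlong (hψ : ContMDiffAt I J 2 ψ p)
    (hg : IsSemiRiemannianAt J g (ψ p)) (hpull : (pullback I J ψ g p).IsInvertible) (u v : E) :
    tangentPart I J g ψ p (covDerivAlong I J g ψ p u v) =
      christoffel I (pullback I J ψ g) p (extChartAt I p p) u v := by
  refine eq_christoffel hpull fun w => ?_
  rw [tangentPart, hpull.self_apply_inverse, christoffelFirst_chartForm_pullback hψ hg,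
    ContinuousLinearMap.comp_apply]

end Charts

theorem map_metricTrace {k : ℕ} {V W : Type*} [AddCommGroup V] [Module ℝ V] [AddCommGroup W]
    [Module ℝ W] (g : EuclideanSpace ℝ (Fin k) →L[ℝ] EuclideanSpace ℝ (Fin k) →L[ℝ] ℝ)
    (B : EuclideanSpace ℝ (Fin k) → EuclideanSpace ℝ (Fin k) → V) (L : V →ₗ[ℝ] W) :
    L (metricTrace g B) = metricTrace g fun u v => L (B u v) := by
  simp [metricTrace, map_sum]

section Product

variable {E₁ : Type*} [NormedAddCommGroup E₁] [NormedSpace ℝ E₁]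
  {H₁ : Type*} [TopologicalSpace H₁] {J₁ : ModelWithCorners ℝ E₁ H₁}
  {E₂ : Type*} [NormedAddCommGroup E₂] [NormedSpace ℝ E₂]
  {H₂ : Type*} [TopologicalSpace H₂] {J₂ : ModelWithCorners ℝ E₂ H₂}
  {N₁ : Type*} [TopologicalSpace N₁] [ChartedSpace H₁ N₁]
  {N₂ : Type*} [TopologicalSpace N₂] [ChartedSpace H₂ N₂]

/-- The product `π₁^* g₁ + π₂^* g₂` of two fields of bilinear forms. -/
noncomputable def prodMetric (g₁ : FormField J₁ N₁) (g₂ : FormField J₂ N₂) :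
    FormField (J₁.prod J₂) (N₁ × N₂) :=
  pullback (J₁.prod J₂) J₁ Prod.fst g₁ + pullback (J₁.prod J₂) J₂ Prod.snd g₂

theorem differential_fst (x : N₁ × N₂) :
    differential (J₁.prod J₂) J₁ Prod.fst x = .fst ℝ E₁ E₂ := mfderiv_fst

theorem differential_snd (x : N₁ × N₂) :
    differential (J₁.prod J₂) J₂ Prod.snd x = .snd ℝ E₁ E₂ := mfderiv_snd

theorem prodMetric_eq (g₁ : FormField J₁ N₁) (g₂ : FormField J₂ N₂) (x : N₁ × N₂) :
    prodMetric g₁ g₂ x =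
      (g₁ x.1).bilinearComp (.fst ℝ E₁ E₂) (.fst ℝ E₁ E₂) +
        (g₂ x.2).bilinearComp (.snd ℝ E₁ E₂) (.snd ℝ E₁ E₂) := by
  simp only [prodMetric, Pi.add_apply, pullback, differential_fst, differential_snd]

theorem prodMetric_apply (g₁ : FormField J₁ N₁) (g₂ : FormField J₂ N₂) (x : N₁ × N₂)
    (u v : E₁ × E₂) : prodMetric g₁ g₂ x u v = g₁ x.1 u.1 v.1 + g₂ x.2 u.2 v.2 := by
  simp [prodMetric_eq]

variable {E : Type*} [NormedAddCommGroup E] [NormedSpace ℝ E]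
  {H : Type*} [TopologicalSpace H] {I : ModelWithCorners ℝ E H}
  {M : Type*} [TopologicalSpace M] [ChartedSpace H M] {ψ : M → N₁ × N₂} {p : M}

theorem differential_eq_prod (hψ : MDifferentiableAt I (J₁.prod J₂) ψ p) :
    differential I (J₁.prod J₂) ψ p =
      (differential I J₁ (fun q => (ψ q).1) p).prod (differential I J₂ (fun q => (ψ q).2) p) :=
  mfderiv_prodMk hψ.fst hψ.snd

variable [J₁.Boundaryless] [J₂.Boundaryless]

theorem writtenInExtChartAt_fst (x : N₁ × N₂) :
    writtenInExtChartAt (J₁.prod J₂) J₁ x Prod.fst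
      =ᶠ[𝓝 (extChartAt (J₁.prod J₂) x x)] Prod.fst := by
  filter_upwards [extChartAt_target_mem_nhds (I := J₁.prod J₂) x] with y hy
  rw [extChartAt_prod] at hy
  simp only [writtenInExtChartAt, extChartAt_prod]
  exact (extChartAt J₁ x.1).right_inv hy.1

theorem writtenInExtChartAt_snd (x : N₁ × N₂) :
    writtenInExtChartAt (J₁.prod J₂) J₂ x Prod.snd
      =ᶠ[𝓝 (extChartAt (J₁.prod J₂) x x)] Prod.snd := by
  filter_upwards [extChartAt_target_mem_nhds (I := J₁.prod J₂) x] with y hy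
  rw [extChartAt_prod] at hy
  simp only [writtenInExtChartAt, extChartAt_prod]
  exact (extChartAt J₂ x.2).right_inv hy.2

variable [IsManifold J₁ 1 N₁] [IsManifold J₂ 1 N₂] {g₁ : FormField J₁ N₁} {g₂ : FormField J₂ N₂}

theorem isSemiRiemannianAt_prodMetric {x : N₁ × N₂} (h₁ : IsSemiRiemannianAt J₁ g₁ x.1)
    (h₂ : IsSemiRiemannianAt J₂ g₂ x.2) :
    IsSemiRiemannianAt (J₁.prod J₂) (prodMetric g₁ g₂) x where
  symm a b := by simp only [prodMetric_apply, h₁.symm a.1, h₂.symm a.2]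
  isInvertible := by
    rw [prodMetric_eq]
    exact isInvertible_bilinearComp_fst_add_snd h₁.isInvertible h₂.isInvertible
  differentiableAt_chartForm :=
    DifferentiableAt.add (𝕜 := ℝ) (f := chartForm _ (pullback (J₁.prod J₂) J₁ Prod.fst g₁) x)
      (g := chartForm _ (pullback (J₁.prod J₂) J₂ Prod.snd g₂) x)
      (differentiableAt_chartForm_pullback contMDiffAt_fst h₁.differentiableAt_chartForm)
      (differentiableAt_chartForm_pullback contMDiffAt_snd h₂.differentiableAt_chartForm)

theorem christoffel_prodMetric {x : N₁ × N₂} (h₁ : IsSemiRiemannianAt J₁ g₁ x.1)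
    (h₂ : IsSemiRiemannianAt J₂ g₂ x.2) (u v : E₁ × E₂) :
    christoffel (J₁.prod J₂) (prodMetric g₁ g₂) x (extChartAt (J₁.prod J₂) x x) u v =
      (christoffel J₁ g₁ x.1 (extChartAt J₁ x.1 x.1) u.1 v.1,
        christoffel J₂ g₂ x.2 (extChartAt J₂ x.2 x.2) u.2 v.2) := by
  refine (eq_christoffel (isSemiRiemannianAt_prodMetric h₁ h₂).isInvertible fun w => ?_).symm
  rw [prodMetric_apply, prodMetric, chartForm_add, christoffelFirst_add
      (differentiableAt_chartForm_pullback contMDiffAt_fst h₁.differentiableAt_chartForm)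
      (differentiableAt_chartForm_pullback contMDiffAt_snd h₂.differentiableAt_chartForm),
    christoffelFirst_chartForm_pullback contMDiffAt_fst h₁,
    christoffelFirst_chartForm_pullback contMDiffAt_snd h₂,
    covDerivAlong_eq_christoffel (L := .fst ℝ E₁ E₂) g₁ (writtenInExtChartAt_fst x),
    covDerivAlong_eq_christoffel (L := .snd ℝ E₁ E₂) g₂ (writtenInExtChartAt_snd x),
    differential_fst, differential_snd]
  rfl

theorem covDerivAlong_prodMetric [I.Boundaryless] (h₁ : IsSemiRiemannianAt J₁ g₁ (ψ p).1)
    (h₂ : IsSemiRiemannianAt J₂ g₂ (ψ p).2) (hψ : ContMDiffAt I (J₁.prod J₂) 2 ψ p) (u v : E) :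
    covDerivAlong I (J₁.prod J₂) (prodMetric g₁ g₂) ψ p u v =
      (covDerivAlong I J₁ g₁ (fun q => (ψ q).1) p u v,
        covDerivAlong I J₂ g₂ (fun q => (ψ q).2) p u v) := by
  set f₁ := writtenInExtChartAt I J₁ p fun q => (ψ q).1
  set f₂ := writtenInExtChartAt I J₂ p fun q => (ψ q).2
  have hf : writtenInExtChartAt I (J₁.prod J₂) p ψ = fun y => (f₁ y, f₂ y) := by
    simp only [f₁, f₂, writtenInExtChartAt, extChartAt_prod]
    rfl
  have hf₁ : ContDiffAt ℝ 2 f₁ (extChartAt I p p) := contDiffAt_writtenInExtChartAt hψ.fst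
  have hf₂ : ContDiffAt ℝ 2 f₂ (extChartAt I p p) := contDiffAt_writtenInExtChartAt hψ.snd
  have hdf : fderiv ℝ (fun y => (f₁ y, f₂ y)) (extChartAt I p p) =
      (fderiv ℝ f₁ (extChartAt I p p)).prod (fderiv ℝ f₂ (extChartAt I p p)) :=
    (hf₁.differentiableAt (by simp)).fderiv_prodMk (hf₂.differentiableAt (by simp))
  have hbase : (f₁ (extChartAt I p p), f₂ (extChartAt I p p)) =
      extChartAt (J₁.prod J₂) (ψ p) (ψ p) := by
    simp only [f₁, f₂, writtenInExtChartAt_self, extChartAt_prod]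
    rfl
  simp only [covDerivAlong, hf, fderiv_fderiv_prodMk hf₁ hf₂, hbase,
    christoffel_prodMetric h₁ h₂, hdf]
  simp [f₁, f₂]

theorem meanCurvature_prodMetric_snd {k : ℕ} {M : Type*} [TopologicalSpace M]
    [ChartedSpace (EuclideanSpace ℝ (Fin k)) M] {ψ : M → N₁ × N₂} {p : M}
    (h₁ : IsSemiRiemannianAt J₁ g₁ (ψ p).1) (h₂ : IsSemiRiemannianAt J₂ g₂ (ψ p).2)
    (hψ : ContMDiffAt (𝓡 k) (J₁.prod J₂) 2 ψ p)
    (hfst : differential (𝓡 k) J₁ (fun q => (ψ q).1) p = 0) :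
    (meanCurvature k (J₁.prod J₂) (prodMetric g₁ g₂) ψ p).2 =
      meanCurvature k J₂ g₂ (fun q => (ψ q).2) p := by
  have hdψ : differential (𝓡 k) (J₁.prod J₂) ψ p =
      (0 : _ →L[ℝ] E₁).prod (differential (𝓡 k) J₂ (fun q => (ψ q).2) p) := by
    rw [differential_eq_prod (hψ.mdifferentiableAt (by simp)), hfst]
  have hpull : pullback (𝓡 k) (J₁.prod J₂) ψ (prodMetric g₁ g₂) p =
      pullback (𝓡 k) J₂ (fun q => (ψ q).2) g₂ p := by
    ext u v
    simp [pullback, hdψ, prodMetric_apply]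
  have htangent (a : E₁ × E₂) : tangentPart (𝓡 k) (J₁.prod J₂) (prodMetric g₁ g₂) ψ p a =
      tangentPart (𝓡 k) J₂ g₂ (fun q => (ψ q).2) p a.2 := by
    rw [tangentPart, tangentPart, hpull]
    congr 1
    ext u
    simp [hdψ, prodMetric_apply]
  have hsff (u v : EuclideanSpace ℝ (Fin k)) :
      (secondFundamentalForm (𝓡 k) (J₁.prod J₂) (prodMetric g₁ g₂) ψ p u v).2 =
        secondFundamentalForm (𝓡 k) J₂ g₂ (fun q => (ψ q).2) p u v := by
    simp [secondFundamentalForm, normalPart, htangent, hdψ, covDerivAlong_prodMetric h₁ h₂ hψ]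
  rw [meanCurvature, Prod.smul_snd, ← LinearMap.snd_apply (R := ℝ), map_metricTrace, hpull]
  simp only [LinearMap.snd_apply, hsff, meanCurvature]

end Product

section Flat

variable {V : Type*} [NormedAddCommGroup V] [NormedSpace ℝ V] {B : V →L[ℝ] V →L[ℝ] ℝ}

theorem chartForm_const (x : V) : chartForm 𝓘(ℝ, V) (fun _ => B) x = fun _ => B := by
  have hchart : ⇑(extChartAt 𝓘(ℝ, V) x).symm = id := by
    simp only [mfld_simps, chartAt_self_eq]
  have hd (y : V) : differential 𝓘(ℝ, V) 𝓘(ℝ, V) id y = .id ℝ V := mfderiv_id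
  ext y u v
  simp only [chartForm, pullback, hchart, hd, ContinuousLinearMap.bilinearComp_apply,
    ContinuousLinearMap.id_apply]

theorem isSemiRiemannianAt_const (hsymm : ∀ a b, B a b = B b a) (hB : B.IsInvertible) (x : V) :
    IsSemiRiemannianAt 𝓘(ℝ, V) (fun _ => B) x where
  symm := hsymm
  isInvertible := hB
  differentiableAt_chartForm := by
    rw [chartForm_const]
    exact differentiableAt_const B

theorem christoffel_const (x y u v : V) : christoffel 𝓘(ℝ, V) (fun _ => B) x y u v = 0 := by
  simp [christoffel, chartForm_const]

theorem covDerivAlong_const {E : Type*} [NormedAddCommGroup E] [NormedSpace ℝ E]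
    {H : Type*} [TopologicalSpace H] {I : ModelWithCorners ℝ E H}
    {M : Type*} [TopologicalSpace M] [ChartedSpace H M] (f : M → V) (p : M) (u v : E) :
    covDerivAlong I 𝓘(ℝ, V) (fun _ => B) f p u v =
      fderiv ℝ (fderiv ℝ (f ∘ (extChartAt I p).symm)) (extChartAt I p p) u v := by
  simp only [covDerivAlong, christoffel_const, add_zero]
  rfl

end Flat

section Height

variable {E : Type*} [NormedAddCommGroup E] [NormedSpace ℝ E]
  {H : Type*} [TopologicalSpace H] {I : ModelWithCorners ℝ E H} [I.Boundaryless]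
  {E' : Type*} [NormedAddCommGroup E'] [NormedSpace ℝ E']
  {H' : Type*} [TopologicalSpace H'] {J : ModelWithCorners ℝ E' H'} [J.Boundaryless]
  {M : Type*} [TopologicalSpace M] [ChartedSpace H M] [IsManifold I 1 M]
  {N : Type*} [TopologicalSpace N] [ChartedSpace H' N] [IsManifold J 1 N]
  {B : ℝ →L[ℝ] ℝ →L[ℝ] ℝ} {g : FormField J N} {ψ : M → ℝ × N} {p : M}

theorem secondFundamentalForm_fst (hB : IsSemiRiemannianAt 𝓘(ℝ, ℝ) (fun _ => B) (ψ p).1)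
    (hg : IsSemiRiemannianAt J g (ψ p).2) (hψ : ContMDiffAt I (𝓘(ℝ, ℝ).prod J) 2 ψ p)
    (hpull : (pullback I (𝓘(ℝ, ℝ).prod J) ψ (prodMetric (fun _ => B) g) p).IsInvertible)
    (u v : E) :
    (secondFundamentalForm I (𝓘(ℝ, ℝ).prod J) (prodMetric (fun _ => B) g) ψ p u v).1 =
      -hessian I (pullback I (𝓘(ℝ, ℝ).prod J) ψ (prodMetric (fun _ => B) g)) (fun q => (ψ q).1)
        p u v := by
  have hψd : MDifferentiableAt I (𝓘(ℝ, ℝ).prod J) ψ p := hψ.mdifferentiableAt (by simp)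
  rw [secondFundamentalForm, normalPart,
    tangentPart_covDerivAlong hψ (isSemiRiemannianAt_prodMetric hB hg) hpull,
    covDerivAlong_prodMetric hB hg hψ, covDerivAlong_const, differential_eq_prod hψd,
    differential_eq_fderiv hψd.fst]
  rfl

theorem laplacian_fst {k : ℕ} (hk : k ≠ 0) {M : Type*} [TopologicalSpace M]
    [ChartedSpace (EuclideanSpace ℝ (Fin k)) M] [IsManifold (𝓡 k) 1 M] {ψ : M → ℝ × N} {p : M}
    (hB : IsSemiRiemannianAt 𝓘(ℝ, ℝ) (fun _ => B) (ψ p).1)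
    (hg : IsSemiRiemannianAt J g (ψ p).2) (hψ : ContMDiffAt (𝓡 k) (𝓘(ℝ, ℝ).prod J) 2 ψ p)
    (hpull : (pullback (𝓡 k) (𝓘(ℝ, ℝ).prod J) ψ (prodMetric (fun _ => B) g) p).IsInvertible) :
    laplacian k (pullback (𝓡 k) (𝓘(ℝ, ℝ).prod J) ψ (prodMetric (fun _ => B) g))
        (fun q => (ψ q).1) p =
      -(k * (meanCurvature k (𝓘(ℝ, ℝ).prod J) (prodMetric (fun _ => B) g) ψ p).1) := by
  have hk' : (k : ℝ) ≠ 0 := by exact_mod_cast hk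
  have h (u v : EuclideanSpace ℝ (Fin k)) := secondFundamentalForm_fst hB hg hψ hpull u v
  rw [meanCurvature, Prod.smul_fst, ← LinearMap.fst_apply (R := ℝ), map_metricTrace]
  simp only [LinearMap.fst_apply, h, laplacian]
  simp [metricTrace, hk']

end Height

section Parabolic

variable {k : ℕ} {M : Type*} [TopologicalSpace M] [ChartedSpace (EuclideanSpace ℝ (Fin k)) M]
  {g : FormField (𝓡 k) M}

theorem laplacian_neg (g : FormField (𝓡 k) M) (u : M → ℝ) (p : M) :
    laplacian k g (-u) p = -laplacian k g u p := by
  have h : (-u) ∘ (extChartAt (𝓡 k) p).symm = -(u ∘ (extChartAt (𝓡 k) p).symm) := rfl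
  have hd : fderiv ℝ (-(u ∘ (extChartAt (𝓡 k) p).symm)) =
      -fderiv ℝ (u ∘ (extChartAt (𝓡 k) p).symm) :=
    funext fun y => fderiv_neg
  have hh (v w) : hessian (𝓡 k) g (-u) p v w = -hessian (𝓡 k) g u p v w := by
    simp only [hessian, h, hd, fderiv_neg, neg_apply]
    ring
  simp only [laplacian, metricTrace, hh, smul_neg, Finset.sum_neg_distrib]

theorem laplacian_const (g : FormField (𝓡 k) M) (c : ℝ) (p : M) :
    laplacian k g (fun _ => c) p = 0 := by
  have h : (fun _ : M => c) ∘ (extChartAt (𝓡 k) p).symm = fun _ => c := rfl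
  have hhess (v w) : hessian (𝓡 k) g (fun _ => c) p v w = 0 := by
    simp only [hessian, h, fderiv_fun_const, Pi.zero_apply, fderiv_zero, zero_apply, sub_zero]
  simp only [laplacian, metricTrace, hhess, smul_zero, Finset.sum_const_zero]

variable {u : M → ℝ}

theorem IsParabolic.exists_eq_const_of_bddAbove (hg : IsParabolic k g)
    (hu : ContMDiff (𝓡 k) 𝓘(ℝ, ℝ) 2 u) (hΔ : ∀ p, 0 ≤ laplacian k g u p)
    (hb : BddAbove (Set.range u)) : ∃ c, ∀ p, u p = c := by
  have hb' : BddBelow (Set.range (-u)) := by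
    have h := hb.neg
    rwa [Set.neg_range] at h
  obtain ⟨c, hc⟩ := hg (-u) hu.neg (fun p => by simpa [laplacian_neg] using hΔ p) hb'
  exact ⟨-c, fun p => neg_eq_iff_eq_neg.1 (hc p)⟩

variable [Nonempty M]

theorem IsParabolic.exists_laplacian_nonneg (hg : IsParabolic k g)
    (hu : ContMDiff (𝓡 k) 𝓘(ℝ, ℝ) 2 u) (hb : BddBelow (Set.range u)) :
    ∃ p, 0 ≤ laplacian k g u p := by
  by_contra! hneg
  obtain ⟨c, hc⟩ := hg u hu (fun p => (hneg p).le) hb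
  obtain ⟨p⟩ := ‹Nonempty M›
  have h := hneg p
  rw [funext hc, laplacian_const] at h
  exact lt_irrefl 0 h

theorem IsParabolic.exists_laplacian_nonpos (hg : IsParabolic k g)
    (hu : ContMDiff (𝓡 k) 𝓘(ℝ, ℝ) 2 u) (hb : BddAbove (Set.range u)) :
    ∃ p, laplacian k g u p ≤ 0 := by
  by_contra! hpos
  obtain ⟨c, hc⟩ := hg.exists_eq_const_of_bddAbove hu (fun p => (hpos p).le) hb
  obtain ⟨p⟩ := ‹Nonempty M›
  have h := hpos p
  rw [funext hc, laplacian_const] at h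
  exact lt_irrefl 0 h

end Parabolic

section Lorentz

variable {m : ℕ} {F : Type*} [TopologicalSpace F] [ChartedSpace (EuclideanSpace ℝ (Fin m)) F]
  [IsManifold (𝓡 m) ∞ F] (gF : RiemannianMetricOn m F)

theorem isSemiRiemannianAt_fiberMetric (x : F) :
    IsSemiRiemannianAt (𝓡 m) (fiberMetric gF) x where
  symm := gF.symm x
  isInvertible := isInvertible_of_apply_self_pos (gF.pos x)
  differentiableAt_chartForm :=
    differentiableAt_chartForm ((gF.contMDiff x).of_le (by simp))

theorem lorentzMetric_eq_prodMetric :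
    lorentzMetric gF = prodMetric (fun _ => -ContinuousLinearMap.mul ℝ ℝ) (fiberMetric gF) := by
  funext x
  rfl

theorem lorentzMetric_apply_timeVector (x : ℝ × F) (v : ℝ × EuclideanSpace ℝ (Fin m)) :
    lorentzMetric gF x v (timeVector m) = -v.1 := by
  simp [lorentzMetric_eq_prodMetric, prodMetric_apply, timeVector]

theorem isSemiRiemannianAt_neg_mul (t : ℝ) :
    IsSemiRiemannianAt 𝓘(ℝ, ℝ) (fun _ => -ContinuousLinearMap.mul ℝ ℝ) t :=
  isSemiRiemannianAt_const (fun a b => by simp [mul_comm]) isInvertible_neg_mul t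

variable {gF} {k : ℕ} {M : Type*} [TopologicalSpace M]
  [ChartedSpace (EuclideanSpace ℝ (Fin k)) M] {ψ : M → ℝ × F}

theorem IsSpacelikeImmersion.contMDiff_height (hψ : IsSpacelikeImmersion k gF ψ) :
    ContMDiff (𝓡 k) 𝓘(ℝ, ℝ) 2 fun p => (ψ p).1 :=
  (hψ.smooth.of_le ENat.LEInfty.out).fst

theorem IsSpacelikeImmersion.laplacian_height [IsManifold (𝓡 k) ∞ M] (hk : k ≠ 0)
    (hψ : IsSpacelikeImmersion k gF ψ) (p : M) :
    laplacian k (inducedMetric k gF ψ) (fun q => (ψ q).1) p =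
      -(k * (meanCurvatureVector k gF ψ p).1) := by
  have hpull : (inducedMetric k gF ψ p).IsInvertible :=
    isInvertible_of_apply_self_pos (hψ.posDef p)
  rw [inducedMetric, lorentzMetric_eq_prodMetric] at hpull
  rw [inducedMetric, meanCurvatureVector, lorentzMetric_eq_prodMetric]
  exact laplacian_fst hk (isSemiRiemannianAt_neg_mul _)
    (isSemiRiemannianAt_fiberMetric gF _) (hψ.smooth.of_le ENat.LEInfty.out p) hpull

theorem IsSpacelikeImmersion.meanCurvatureVector_snd {t₀ : ℝ}
    (hψ : IsSpacelikeImmersion k gF ψ) (ht₀ : ∀ p, (ψ p).1 = t₀) (p : M) :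
    (meanCurvatureVector k gF ψ p).2 =
      meanCurvature k (𝓡 m) (fiberMetric gF) (fun q => (ψ q).2) p := by
  have hfst : differential (𝓡 k) 𝓘(ℝ, ℝ) (fun q => (ψ q).1) p = 0 := by
    rw [funext ht₀]
    exact mfderiv_const
  rw [meanCurvatureVector, lorentzMetric_eq_prodMetric]
  exact meanCurvature_prodMetric_snd (isSemiRiemannianAt_neg_mul _)
    (isSemiRiemannianAt_fiberMetric gF _) (hψ.smooth.of_le ENat.LEInfty.out p) hfst

theorem IsSpacelikeImmersion.not_forall_isFutureCausal [IsManifold (𝓡 k) ∞ M] [Nonempty M]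
    (hk : k ≠ 0) (hψ : IsSpacelikeImmersion k gF ψ) (hpar : IsParabolic k (inducedMetric k gF ψ))
    (hb : BoundedAwayFromPastInfinity ψ) :
    ¬ ∀ p, IsFutureCausal gF (ψ p) (meanCurvatureVector k gF ψ p) := by
  intro hH
  obtain ⟨a, ha⟩ := hb
  obtain ⟨p, hp⟩ := hpar.exists_laplacian_nonneg hψ.contMDiff_height ⟨a, Set.forall_mem_range.2 ha⟩
  have hpos : 0 < (meanCurvatureVector k gF ψ p).1 := by
    simpa only [lorentzMetric_apply_timeVector, neg_lt_zero] using (hH p).2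
  rw [hψ.laplacian_height hk] at hp
  exact (neg_neg_of_pos (mul_pos (Nat.cast_pos.2 hk.bot_lt) hpos)).not_ge hp

theorem IsSpacelikeImmersion.not_forall_isPastCausal [IsManifold (𝓡 k) ∞ M] [Nonempty M]
    (hk : k ≠ 0) (hψ : IsSpacelikeImmersion k gF ψ) (hpar : IsParabolic k (inducedMetric k gF ψ))
    (hb : BoundedAwayFromFutureInfinity ψ) :
    ¬ ∀ p, IsPastCausal gF (ψ p) (meanCurvatureVector k gF ψ p) := by
  intro hH
  obtain ⟨b, hb⟩ := hb
  obtain ⟨p, hp⟩ := hpar.exists_laplacian_nonpos hψ.contMDiff_height ⟨b, Set.forall_mem_range.2 hb⟩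
  have hneg : (meanCurvatureVector k gF ψ p).1 < 0 := by
    simpa only [lorentzMetric_apply_timeVector, neg_pos] using (hH p).2
  rw [hψ.laplacian_height hk] at hp
  exact (neg_pos.2 (mul_neg_of_pos_of_neg (Nat.cast_pos.2 hk.bot_lt) hneg)).not_ge hp

theorem IsExtremal.exists_height_eq_const [IsManifold (𝓡 k) ∞ M] (hH : IsExtremal k gF ψ)
    (hk : k ≠ 0) (hψ : IsSpacelikeImmersion k gF ψ) (hpar : IsParabolic k (inducedMetric k gF ψ))
    (hb : BoundedAwayFromFutureInfinity ψ ∨ BoundedAwayFromPastInfinity ψ) :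
    ∃ t₀, ∀ p, (ψ p).1 = t₀ := by
  have hharm (p : M) : laplacian k (inducedMetric k gF ψ) (fun q => (ψ q).1) p = 0 := by
    rw [hψ.laplacian_height hk, hH p, Prod.fst_zero, mul_zero, neg_zero]
  rcases hb with ⟨b, hb⟩ | ⟨a, ha⟩
  · exact hpar.exists_eq_const_of_bddAbove hψ.contMDiff_height (fun p => (hharm p).ge)
      ⟨b, Set.forall_mem_range.2 hb⟩
  · exact hpar _ hψ.contMDiff_height (fun p => (hharm p).le) ⟨a, Set.forall_mem_range.2 ha⟩

theorem IsSpacelikeImmersion.isExtremal_iff_of_height_eq_const [IsManifold (𝓡 k) ∞ M] {t₀ : ℝ}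
    (hk : k ≠ 0) (hψ : IsSpacelikeImmersion k gF ψ) (ht₀ : ∀ p, (ψ p).1 = t₀) :
    IsExtremal k gF ψ ↔
      ∀ p, meanCurvature k (𝓡 m) (fiberMetric gF) (fun q => (ψ q).2) p = 0 := by
  have hfst (p : M) : (meanCurvatureVector k gF ψ p).1 = 0 := by
    have h := hψ.laplacian_height hk p
    rw [funext ht₀, laplacian_const] at h
    simpa only [zero_eq_neg, mul_eq_zero, Nat.cast_eq_zero, hk, false_or] using h
  simp only [IsExtremal, Prod.ext_iff, hfst, hψ.meanCurvatureVector_snd ht₀, Prod.fst_zero,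
    Prod.snd_zero, true_and]

end Lorentz

end LorentzProduct

open LorentzProduct in
theorem corollary4p5_general {m k : ℕ} (hk : 1 ≤ k)
    {F : Type*} [TopologicalSpace F] [ChartedSpace (EuclideanSpace ℝ (Fin m)) F]
    [IsManifold (𝓡 m) ∞ F] (gF : RiemannianMetricOn m F)
    {M : Type*} [TopologicalSpace M] [Nonempty M] [ChartedSpace (EuclideanSpace ℝ (Fin k)) M]
    [IsManifold (𝓡 k) ∞ M] (ψ : M → ℝ × F) (hψ : IsSpacelikeImmersion k gF ψ)
    (hpar : IsParabolic k (inducedMetric k gF ψ)) :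
    (BoundedAwayFromPastInfinity ψ →
        ¬ ∀ p, IsFutureCausal gF (ψ p) (meanCurvatureVector k gF ψ p)) ∧
      (BoundedAwayFromFutureInfinity ψ →
        ¬ ∀ p, IsPastCausal gF (ψ p) (meanCurvatureVector k gF ψ p)) ∧
      ((IsExtremal k gF ψ ∧ (BoundedAwayFromFutureInfinity ψ ∨ BoundedAwayFromPastInfinity ψ)) ↔
        IsMinimalInSlice k gF ψ) := by
  have hk : k ≠ 0 := Nat.one_le_iff_ne_zero.1 hk
  refine ⟨hψ.not_forall_isFutureCausal hk hpar, hψ.not_forall_isPastCausal hk hpar, ?_, ?_⟩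
  · rintro ⟨hH, hb⟩
    obtain ⟨t₀, ht₀⟩ := hH.exists_height_eq_const hk hψ hpar hb
    exact ⟨t₀, ht₀, (hψ.isExtremal_iff_of_height_eq_const hk ht₀).1 hH⟩
  · rintro ⟨t₀, ht₀, hmin⟩
    exact ⟨(hψ.isExtremal_iff_of_height_eq_const hk ht₀).2 hmin, .inl ⟨t₀, fun p => (ht₀ p).le⟩⟩

open LorentzProduct in
theorem corollary4p5 {m k : ℕ} (hm : 2 ≤ m) (hk : 1 ≤ k)
    {F : Type*} [TopologicalSpace F] [T2Space F] [SecondCountableTopology F] [ConnectedSpace F]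
    [ChartedSpace (EuclideanSpace ℝ (Fin m)) F] [IsManifold (𝓡 m) ∞ F]
    (gF : RiemannianMetricOn m F)
    {M : Type*} [TopologicalSpace M] [T2Space M] [SecondCountableTopology M] [ConnectedSpace M]
    [ChartedSpace (EuclideanSpace ℝ (Fin k)) M] [IsManifold (𝓡 k) ∞ M]
    (ψ : M → ℝ × F) (hψ : IsSpacelikeImmersion k gF ψ)
    (hpar : IsParabolic k (inducedMetric k gF ψ)) :
    (InSlab ψ → ¬ IsWeaklyTrapped k gF ψ) ∧
      ((IsExtremal k gF ψ ∧ (BoundedAwayFromFutureInfinity ψ ∨ BoundedAwayFromPastInfinity ψ)) ↔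
        IsMinimalInSlice k gF ψ) := by
  obtain ⟨hfuture, hpast, hmin⟩ := corollary4p5_general hk gF ψ hψ hpar
  exact ⟨fun ⟨a, b, hab⟩ => not_or.2 ⟨hfuture ⟨a, fun p => (hab p).1⟩,
    hpast ⟨b, fun p => (hab p).2⟩⟩, hmin⟩
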